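/- Let $G$ be a finite group. For an irreducible finite-dimensional complex representation $R$ of $G$ and a conjugacy class $C$ let $\chi^R_C=\chi^R(g)$ for any $g\in C$, where $\chi^R$ is the character of $R$. Let $\mathrm{Irr}(G)$ be the finite set of isomorphism classes of irreducible complex representations of $G$, let $\bar S$ be the dual of $S$, and let $$N^{R}_{S\bar S}=\dim\mathrm{Hom}_G(R,\,S\otimes\bar S)$$ be the fusion coefficient, i.e. the multiplicity of $R$ in $S\otimes\bar S$. Then for every irreducible representation $R$ of $G$ the following hold. (1) The row sum of the character table is a non-negative integer, and equals a sum of fusion multiplicities: $$\sum_{C}\chi^R_C=\sum_{S\in\mathrm{Irr}(G)}N^R_{S\bar S}\in\mathbb Z_{\ge 0},$$ where $C$ runs over all conjugacy classes of $G$. (2) This integer is strictly positive if and only if there are an irreducible representation $S$ and a non-zero $G$-equivariant map $R\to S\otimes\bar S$. (3) For every $S\in\mathrm{Irr}(G)$, $\displaystyle N^R_{S\bar S}=\frac1{|G|}\sum_{g\in G}\chi^S(g)\,\chi^{\bar S}(g)\,\overline{\chi^R(g)}$. -/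

import Mathlib

open CategoryTheory MonoidalCategory

universe u

/-- The value of the character of `V` on a conjugacy class, i.e. the value at any element of it. -/
noncomputable def classCharacter {G : Type u} [Group G] (V : FDRep ℂ G) : ConjClasses G → ℂ :=
  Quotient.lift (fun g => V.character g) (by
    intro a b h
    obtain ⟨c, rfl⟩ := isConj_iff.mp h
    exact (V.char_conj a c).symm)

/-- The dual (contragredient) representation. -/
noncomputable def dualRep {G : Type u} [Group G] (V : FDRep ℂ G) : FDRep ℂ G :=
  FDRep.of (Representation.dual V.ρ)

/-- The fusion coefficient `N_{V W}^R`: for irreducible `R`, the dimension of the space of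
`G`-equivariant maps `R → V ⊗ W` is the multiplicity of `R` in `V ⊗ W`. -/
noncomputable def fusionCoeff {G : Type u} [Group G] (V W R : FDRep ℂ G) : ℕ :=
  Module.finrank ℂ (R ⟶ V ⊗ W)

/-- Isomorphism of irreducible finite-dimensional complex representations. -/
def irrepSetoid (G : Type u) [Group G] : Setoid {V : FDRep ℂ G // Simple V} where
  r V W := Nonempty (V.1 ≅ W.1)
  iseqv :=
    { refl := fun V => ⟨Iso.refl V.1⟩
      symm := fun ⟨i⟩ => ⟨i.symm⟩
      trans := fun ⟨i⟩ ⟨j⟩ => ⟨i.trans j⟩ }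

/-- The set of isomorphism classes of irreducible complex representations of `G`. -/
def IrrepClass (G : Type u) [Group G] := Quotient (irrepSetoid G)

/-- A representation in the given isomorphism class. -/
noncomputable def IrrepClass.rep {G : Type u} [Group G] (S : IrrepClass G) : FDRep ℂ G :=
  (Quotient.out S).1

instance IrrepClass.simple_rep {G : Type u} [Group G] (S : IrrepClass G) : Simple S.rep :=
  (Quotient.out S).2

theorem IrrepClass.eq_of_iso {G : Type u} [Group G] {S T : IrrepClass G}
    (h : Nonempty (S.rep ≅ T.rep)) : S = T :=
  Quotient.out_equiv_out.mp h

theorem IrrepClass.exists_iso {G : Type u} [Group G] (V : FDRep ℂ G) [hV : Simple V] :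
    ∃ S : IrrepClass G, Nonempty (S.rep ≅ V) :=
  ⟨Quotient.mk (irrepSetoid G) ⟨V, hV⟩,
    Quotient.mk_out (s := irrepSetoid G) (⟨V, hV⟩ : {V : FDRep ℂ G // Simple V})⟩

theorem IrrepClass.linearIndependent_character {G : Type u} [Group G] [Fintype G] :
    LinearIndependent ℂ (fun S : IrrepClass G => S.rep.character) := by
  classical
  have : Invertible (Nat.card G : ℂ) :=
    invertibleOfNonzero (Nat.cast_ne_zero.mpr Nat.card_pos.ne')
  rw [linearIndependent_iff']
  intro s c hc T hT
  have key : ∑ S ∈ s, c S * ((Nat.card G : ℂ)⁻¹ *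
      ∑ g : G, S.rep.character g * T.rep.character g⁻¹) = 0 := by
    have h : ∀ g : G, ∑ S ∈ s, c S * S.rep.character g = 0 := fun g => by
      simpa using congrFun hc g
    calc _ = (Nat.card G : ℂ)⁻¹ * ∑ g : G, (∑ S ∈ s, c S * S.rep.character g)
              * T.rep.character g⁻¹ := by
            simp only [Finset.sum_mul]
            rw [Finset.sum_comm, Finset.mul_sum]
            refine Finset.sum_congr rfl fun S _ => ?_
            simp only [mul_assoc, ← Finset.mul_sum]
            ring
      _ = 0 := by simp [h]
  simp only [FDRep.char_orthonormal] at key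
  rw [Finset.sum_eq_single T] at key
  · simpa using key
  · intro S _ hST
    rw [if_neg fun h => hST (IrrepClass.eq_of_iso h), mul_zero]
  · exact fun h => absurd hT h

instance IrrepClass.finite {G : Type u} [Group G] [Finite G] : Finite (IrrepClass G) := by
  have := Fintype.ofFinite G
  exact IrrepClass.linearIndependent_character.finite

noncomputable instance IrrepClass.fintype {G : Type u} [Group G] [Finite G] :
    Fintype (IrrepClass G) :=
  Fintype.ofFinite _

/-! Averaging characters gives N^R_{S S̄} = |G|⁻¹ ∑_g χ^S(g) χ^S(g⁻¹) χ^R(g⁻¹). Sum over S: by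
column orthogonality ∑_S χ^S(g) χ^S(g⁻¹) is the order of the centralizer of g. Weighting each g by
|C_G(g)|/|G| counts every conjugacy class once, so the total is the row sum of R. Positivity then
means that one summand is nonzero. Column orthogonality follows from row orthogonality once
irreducible characters are known to span the class functions (`eq_zero_of_orthogonal_irreducible`).
-/

namespace Representation

/-! ### Conjugate characters and completeness -/

/-- The trace of the inverse of a group element is the conjugate of its trace: averaging
`ρ(g)ᴴ ρ(g)` over the group gives an invariant positive definite Hermitian form. -/
theorem character_inv_eq_conj {G V : Type*} [Group G] [Finite G] [AddCommGroup V] [Module ℂ V]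
    [FiniteDimensional ℂ V] (ρ : Representation ℂ G V) (g : G) :
    ρ.character g⁻¹ = (starRingEnd ℂ) (ρ.character g) := by
  classical
  open scoped ComplexOrder in
  have := Fintype.ofFinite G
  let b := Module.finBasis ℂ V
  let M : G → Matrix (Fin (Module.finrank ℂ V)) (Fin (Module.finrank ℂ V)) ℂ :=
    fun x => LinearMap.toMatrix b b (ρ x)
  have M_mul : ∀ x y, M (x * y) = M x * M y := fun x y => by
    simp only [M, map_mul]
    exact LinearMap.toMatrix_mul b (ρ x) (ρ y)
  have M_one : M 1 = 1 := by simp only [M, map_one]; exact LinearMap.toMatrix_one b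
  have char_eq : ∀ x, ρ.character x = (M x).trace := fun x =>
    LinearMap.trace_eq_matrix_trace ℂ b (ρ x)
  let H := ∑ x : G, (M x).conjTranspose * M x
  have H_unit : IsUnit H := by
    have : H.PosDef := by
      -- The term at 1 is the identity matrix, which alone makes the sum positive definite.
      have hsum : H = (M 1).conjTranspose * M 1 +
          ∑ x ∈ Finset.univ.erase 1, (M x).conjTranspose * M x :=
        (Finset.add_sum_erase _ _ (Finset.mem_univ _)).symm
      rw [hsum, M_one, Matrix.conjTranspose_one, one_mul]
      exact Matrix.PosDef.one.add_posSemidef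
        (Matrix.posSemidef_sum _ fun x _ => Matrix.posSemidef_conjTranspose_mul_self _)
    exact this.isUnit
  have H_inv : (M g).conjTranspose * H * M g = H := by
    simp only [H, Finset.mul_sum, Finset.sum_mul]
    refine Fintype.sum_equiv (Equiv.mulRight g) _ _ fun x => ?_
    simp [M_mul, Matrix.conjTranspose_mul, mul_assoc]
  have hdet := (Matrix.isUnit_iff_isUnit_det _).mp H_unit
  have key : H * M g⁻¹ * H⁻¹ = (M g).conjTranspose := by
    have h1 : (M g).conjTranspose * H = H * M g⁻¹ := by
      conv_rhs => rw [← H_inv]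
      rw [mul_assoc _ (M g), ← M_mul, mul_inv_cancel, M_one, mul_one]
    rw [← h1, mul_assoc, Matrix.mul_nonsing_inv _ hdet, mul_one]
  rw [char_eq, char_eq]
  have h2 : (starRingEnd ℂ) (M g).trace = (M g).conjTranspose.trace :=
    (Matrix.trace_conjTranspose _).symm
  rw [h2, ← key, Matrix.trace_mul_comm, ← mul_assoc, Matrix.nonsing_inv_mul _ hdet, one_mul]

/-- A class function orthogonal to all irreducible characters vanishes. -/
theorem eq_zero_of_orthogonal_irreducible {G : Type u} [Group G] [Fintype G] (f : G → ℂ)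
    (hf : ∀ k g, f (k * g * k⁻¹) = f g)
    (h : ∀ (V : Type u) [AddCommGroup V] [Module ℂ V] [FiniteDimensional ℂ V]
      (ρ : Representation ℂ G V) [IsIrreducible ρ], ∑ g, f g * ρ.character g = 0) :
    f = 0 := by
  classical
  have : NeZero (Nat.card G : ℂ) := ⟨Nat.cast_ne_zero.mpr Nat.card_pos.ne'⟩
  have hfd : FiniteDimensional ℂ (MonoidAlgebra ℂ G) :=
    Module.Finite.of_basis (MonoidAlgebra.basis G ℂ)
  let a : MonoidAlgebra ℂ G := ∑ g, MonoidAlgebra.single g (f g)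
  have a_apply : ∀ g, a.coeff g = f g := fun g => by
    simp [a, Finsupp.single_apply]
  have a_comm_of : ∀ k, a * MonoidAlgebra.of ℂ G k = MonoidAlgebra.of ℂ G k * a := fun k => by
    simp only [a, Finset.mul_sum, Finset.sum_mul, MonoidAlgebra.of_apply,
      MonoidAlgebra.single_mul_single, one_mul, mul_one]
    refine Fintype.sum_equiv (MulAut.conj k⁻¹).toEquiv _ _ fun g => ?_
    have := hf k⁻¹ g
    simp only [inv_inv, mul_assoc] at this
    simp [this, mul_assoc]
  have a_comm : ∀ x, a * x = x * a := fun x => by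
    induction x using MonoidAlgebra.induction_on with
    | of k => exact a_comm_of k
    | add x y hx hy => rw [mul_add, add_mul, hx, hy]
    | smul r x hx => rw [mul_smul_comm, smul_mul_assoc, hx]
  -- By Schur, the central element `a` acts on a simple left ideal as a scalar `c`; its trace `c *
  -- dim N` is `∑ f g * χ(g) = 0`.
  have ann : ∀ N : Submodule (MonoidAlgebra ℂ G) (MonoidAlgebra ℂ G),
      IsSimpleModule (MonoidAlgebra ℂ G) N → ∀ x ∈ N, a • x = 0 := by
    intro N hN x hx
    have : FiniteDimensional ℂ N :=
      inferInstanceAs (FiniteDimensional ℂ (N.restrictScalars ℂ))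
    let ρ : Representation ℂ G N := ofModule' N
    have hlift : ∀ (r : MonoidAlgebra ℂ G) (y : N), ρ.asAlgebraHom r y = r • y := fun r y => by
      induction r using MonoidAlgebra.induction_on with
      | of k => rw [asAlgebraHom_of]; rfl
      | add r s hr hs => rw [map_add, LinearMap.add_apply, hr, hs, add_smul]
      | smul c r hr => rw [map_smul, LinearMap.smul_apply, hr, smul_assoc]
    have hρ : ρ.IsIrreducible := by
      rw [irreducible_iff_isSimpleModule_asModule]
      exact IsSimpleModule.congr (N := N)
        { ρ.asModuleEquiv.toAddEquiv with
          map_smul' := fun r y => (ρ.asModuleEquiv_map_smul r y).trans (hlift r _) }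
    let T : Module.End (MonoidAlgebra ℂ G) N :=
      { toFun := fun y => a • y
        map_add' := smul_add a
        map_smul' := fun r y => by simp [smul_smul, a_comm] }
    obtain ⟨c, hc⟩ := (IsSimpleModule.algebraMap_end_bijective_of_isAlgClosed ℂ
      (A := MonoidAlgebra ℂ G) (V := N)).2 T
    have hact : ∀ y : N, a • y = c • y := fun y => (congr($hc y)).symm
    have htr : c * Module.finrank ℂ N = 0 := by
      rw [← h N ρ, ← smul_eq_mul, ← LinearMap.trace_one, ← map_smul]
      have : c • (1 : N →ₗ[ℂ] N) = ∑ g, f g • ρ g := by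
        ext y : 1
        refine (hact y).symm.trans ((hlift a y).symm.trans ?_)
        simp [a, asAlgebraHom_single]
      rw [this, map_sum]
      simp [character]
    have := IsSimpleModule.nontrivial (MonoidAlgebra ℂ G) N
    have hc0 : c = 0 := by
      simpa [Module.finrank_pos.ne'] using htr
    have := hact ⟨x, hx⟩
    rw [hc0, zero_smul] at this
    exact congrArg Subtype.val this
  -- By Maschke the simple left ideals span the group algebra, so `a` kills 1.
  have htop : (⊤ : Submodule (MonoidAlgebra ℂ G) (MonoidAlgebra ℂ G)) ≤
      LinearMap.ker ({ toFun := fun y => a • y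
                       map_add' := smul_add a
                       map_smul' := fun r y => by
                        simp [← mul_assoc, a_comm] } :
        Module.End (MonoidAlgebra ℂ G) (MonoidAlgebra ℂ G)) := by
    rw [← IsSemisimpleModule.sSup_simples_eq_top]
    exact sSup_le fun N hN x hx => ann N hN x hx
  have ha : a = 0 := by simpa using htop (Submodule.mem_top (x := (1 : MonoidAlgebra ℂ G)))
  ext g
  rw [← a_apply, ha]
  rfl

end Representation

/-! ### Irreducible representations as simple objects -/

/-- The representation afforded by an irreducible `ρ` is a simple object. -/
theorem FDRep.simple_of {G : Type u} {V : Type} [Group G] [AddCommGroup V] [Module ℂ V]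
    [FiniteDimensional ℂ V] (ρ : Representation ℂ G V) [ρ.IsIrreducible] :
    Simple (FDRep.of ρ) where
  mono_isIso_iff_nonzero {W} f hf := by
    let φ : Representation.IntertwiningMap W.ρ ρ := ⟨f.hom.hom.hom, fun g => by
      have := congrArg (fun t => t.hom.hom) (f.comm g)
      exact this⟩
    constructor
    · rintro hiso rfl
      have := (Representation.irreducible_iff_isSimpleModule_asModule ρ).mp inferInstance
      have : Nontrivial V := IsSimpleModule.nontrivial (MonoidAlgebra ℂ G) ρ.asModule
      obtain ⟨x, hx⟩ := exists_ne (0 : V)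
      have hid : 𝟙 (FDRep.of ρ) = 0 := by
        rw [← IsIso.inv_hom_id (0 : W ⟶ FDRep.of ρ), Limits.comp_zero]
      have := congrArg (fun t => t.hom.hom.hom x) hid
      exact hx this
    · intro hne
      have hsurj : Function.Surjective φ := by
        refine (Representation.IsIrreducible.surjective_or_eq_zero φ).resolve_right ?_
        intro h0
        apply hne
        ext x
        exact congr($h0 x)
      have hinj : Function.Injective φ := by
        have : Mono ((forget₂ (FDRep ℂ G) (Rep ℂ G)).map f) := inferInstance
        exact (Rep.mono_iff_injective _).mp this
      let e : W ≃ₗ[ℂ] V := LinearEquiv.ofBijective φ.toLinearMap ⟨hinj, hsurj⟩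
      have : IsIso f.hom := (LinearEquiv.toFGModuleCatIso e).isIso_hom
      exact Action.isIso_of_hom_isIso f

/-- Objects of `FDRep ℂ G` live in `Type`, but simple left ideals of the group algebra need not;
coordinates move `ρ` to `Fin n → ℂ`. -/
theorem exists_irrepClass_character_eq {G : Type u} {V : Type*} [Group G] [AddCommGroup V]
    [Module ℂ V] [FiniteDimensional ℂ V] (ρ : Representation ℂ G V) [ρ.IsIrreducible] :
    ∃ S : IrrepClass G, S.rep.character = ρ.character := by
  let e : V ≃ₗ[ℂ] (Fin (Module.finrank ℂ V) → ℂ) := (Module.finBasis ℂ V).equivFun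
  let σ : Representation ℂ G (Fin (Module.finrank ℂ V) → ℂ) :=
    (e.conjAlgEquiv ℂ).toAlgHom.toMonoidHom.comp ρ
  let i : Representation.Equiv ρ σ :=
    { toIntertwiningMap := ⟨e, fun g => by ext; simp [σ]⟩
      invFun := e.symm
      left_inv := e.left_inv
      right_inv := e.right_inv }
  have hσ : σ.IsIrreducible := by
    rw [Representation.irreducible_iff_isSimpleModule_asModule]
    exact IsSimpleModule.congr (LinearEquiv.ofBijective
      (Representation.IntertwiningMap.equivLinearMapAsModule ρ σ i.toIntertwiningMap)
      e.bijective).symm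
  have := FDRep.simple_of σ
  obtain ⟨S, ⟨j⟩⟩ := IrrepClass.exists_iso (FDRep.of σ)
  exact ⟨S, (FDRep.char_iso j).trans (Representation.char_iso i).symm⟩

/-! ### Class sums and column orthogonality -/

/-- Summing a function of the conjugacy class over the commuting pairs of `G`. -/
theorem sum_conjClasses_mul_card_centralizer {G : Type*} [Group G] [Fintype G] [DecidableEq G]
    [Fintype (ConjClasses G)] (F : ConjClasses G → ℂ) :
    ∑ x : G, F (ConjClasses.mk x) * ∑ k : G, (if k * x * k⁻¹ = x then (1 : ℂ) else 0) =
      Fintype.card G * ∑ C, F C := by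
  classical
  -- With a fixed representative of the class, each `k` hits exactly one `x`, so summing over `x`
  -- gives `|G|`.
  have hout : ∀ x : G, ∑ k : G, (if k * x * k⁻¹ = x then (1 : ℂ) else 0) =
      ∑ k : G, (if k * (ConjClasses.mk x).out * k⁻¹ = x then (1 : ℂ) else 0) := by
    intro x
    obtain ⟨c, hc⟩ := isConj_iff.mp (ConjClasses.mk_eq_mk_iff_isConj.mp
      (Quotient.out_eq (ConjClasses.mk x)))
    refine Fintype.sum_equiv (Equiv.mulRight c) _ _ fun k => ?_
    have : k * c * (ConjClasses.mk x).out * (k * c)⁻¹ = k * x * k⁻¹ := by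
      conv_rhs => rw [← hc]
      group
    simp only [Equiv.coe_mulRight, this]
  have hfib : ∀ x : G, F (ConjClasses.mk x) *
      ∑ k : G, (if k * (ConjClasses.mk x).out * k⁻¹ = x then (1 : ℂ) else 0) =
      ∑ C, F C * ∑ k : G, (if k * C.out * k⁻¹ = x then (1 : ℂ) else 0) := by
    intro x
    symm
    refine Fintype.sum_eq_single (ConjClasses.mk x) fun C hC => ?_
    refine mul_eq_zero_of_right _ (Finset.sum_eq_zero fun k _ => if_neg fun hk => hC ?_)
    rw [← hk]
    exact (Quotient.out_eq C).symm.trans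
      (ConjClasses.mk_eq_mk_iff_isConj.mpr (isConj_iff.mpr ⟨k, rfl⟩))
  simp_rw [hout, hfib]
  rw [Finset.sum_comm, Finset.mul_sum]
  refine Finset.sum_congr rfl fun C _ => ?_
  rw [← Finset.mul_sum, Finset.sum_comm]
  simp [mul_comm]

/-- The second orthogonality relation for irreducible characters, where the order of the
centralizer is written as a count of conjugating elements. -/
theorem sum_irrepClass_character_mul_character_inv {G : Type u} [Group G] [Fintype G]
    [DecidableEq G] (h x : G) :
    ∑ S : IrrepClass G, S.rep.character x * S.rep.character h⁻¹ =
      ∑ k : G, (if k * h * k⁻¹ = x then (1 : ℂ) else 0) := by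
  classical
  have hcard : (Nat.card G : ℂ) ≠ 0 := Nat.cast_ne_zero.mpr Nat.card_pos.ne'
  have : Invertible (Nat.card G : ℂ) := invertibleOfNonzero hcard
  have hsum : ∀ F : G → ℂ, ∑ y, F y⁻¹ = ∑ y, F y := fun F => Equiv.sum_comp (Equiv.inv G) F
  -- The inverse on `y` is there because the completeness criterion pairs with χ unconjugated.
  let f : G → ℂ := fun y => ∑ S : IrrepClass G, S.rep.character y⁻¹ * S.rep.character h⁻¹ -
    ∑ k : G, (if k * h * k⁻¹ = y⁻¹ then (1 : ℂ) else 0)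
  suffices hf : f = 0 by simpa [f, sub_eq_zero] using congrFun hf x⁻¹
  refine Representation.eq_zero_of_orthogonal_irreducible f (fun c y => ?_) fun V _ _ _ ρ _ => ?_
  · have hinv : (c * y * c⁻¹)⁻¹ = c * y⁻¹ * c⁻¹ := by group
    simp only [f, hinv, FDRep.char_conj]
    refine congrArg _ (Fintype.sum_equiv (Equiv.mulLeft c) _ _ fun k => ?_).symm
    have : c * k * h * (c * k)⁻¹ = c * (k * h * k⁻¹) * c⁻¹ := by group
    simp only [Equiv.coe_mulLeft, this, mul_left_inj, mul_right_inj]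
  · obtain ⟨T, hT⟩ := exists_irrepClass_character_eq ρ
    rw [← hT]
    have horth : ∀ S : IrrepClass G, ∑ y, S.rep.character y⁻¹ * T.rep.character y =
        if S = T then (Nat.card G : ℂ) else 0 := by
      intro S
      have h1 := FDRep.char_orthonormal S.rep T.rep
      rw [← hsum, inv_mul_eq_iff_eq_mul₀ hcard] at h1
      simp only [inv_inv] at h1
      rw [h1]
      by_cases hST : S = T
      · subst hST
        simp [show Nonempty (S.rep ≅ S.rep) from ⟨Iso.refl _⟩]
      · rw [if_neg hST, if_neg fun hi => hST (IrrepClass.eq_of_iso hi), mul_zero]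
    simp only [f, sub_mul, Finset.sum_sub_distrib, Finset.sum_mul]
    rw [sub_eq_zero]
    calc _ = ∑ S : IrrepClass G, S.rep.character h⁻¹ *
          ∑ y, S.rep.character y⁻¹ * T.rep.character y := by
          rw [Finset.sum_comm]
          simp only [Finset.mul_sum]
          exact Finset.sum_congr rfl fun S _ => Finset.sum_congr rfl fun y _ => by ring
      _ = ∑ k : G, T.rep.character (k * h * k⁻¹)⁻¹ := by
          have hconj : ∀ k : G, (k * h * k⁻¹)⁻¹ = k * h⁻¹ * k⁻¹ := fun k => by group
          simp only [horth, hconj, FDRep.char_conj]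
          simp [mul_comm]
      _ = ∑ k : G, ∑ y, (if k * h * k⁻¹ = y then (1 : ℂ) else 0) * T.rep.character y⁻¹ := by
          simp
      _ = _ := by
          rw [Finset.sum_comm, ← hsum]
          simp only [inv_inv]

/-! ### Fusion coefficients and row sums -/

/-- The fusion coefficient of a representation and its dual as a character average. -/
theorem fusionCoeff_dualRep_eq {G : Type u} [Group G] [Fintype G] (S R : FDRep ℂ G) :
    (fusionCoeff S (dualRep S) R : ℂ) = (Fintype.card G : ℂ)⁻¹ *
      ∑ g : G, S.character g * (dualRep S).character g * R.character g⁻¹ := by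
  have : Invertible (Nat.card G : ℂ) :=
    invertibleOfNonzero (Nat.cast_ne_zero.mpr Nat.card_pos.ne')
  rw [fusionCoeff, ← FDRep.scalar_product_char_eq_finrank_equivariant, FDRep.char_tensor,
    Fintype.card_eq_nat_card]
  rfl

theorem dualRep_character {G : Type u} [Group G] (S : FDRep ℂ G) (g : G) :
    (dualRep S).character g = S.character g⁻¹ :=
  FDRep.char_dual S g

/-- Needed to pass from an arbitrary simple `S` to the chosen representative of its class. -/
theorem fusionCoeff_dualRep_congr {G : Type u} [Group G] [Fintype G] {S T : FDRep ℂ G}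
    (i : S ≅ T) (R : FDRep ℂ G) :
    fusionCoeff S (dualRep S) R = fusionCoeff T (dualRep T) R := by
  have : (fusionCoeff S (dualRep S) R : ℂ) = fusionCoeff T (dualRep T) R := by
    simp only [fusionCoeff_dualRep_eq, dualRep_character, FDRep.char_iso i]
  exact_mod_cast this

theorem fusionCoeff_pos_iff {G : Type u} [Group G] (V W R : FDRep ℂ G) :
    0 < fusionCoeff V W R ↔ ∃ f : R ⟶ V ⊗ W, f ≠ 0 :=
  Module.finrank_pos_iff_exists_ne_zero

theorem sum_classCharacter_eq_sum_fusionCoeff {G : Type u} [Group G] [Fintype G]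
    [Fintype (ConjClasses G)] (R : FDRep ℂ G) :
    ∑ C : ConjClasses G, classCharacter R C =
      ∑ S : IrrepClass G, (fusionCoeff S.rep (dualRep S.rep) R : ℂ) := by
  classical
  have hcard : (Fintype.card G : ℂ) ≠ 0 := Nat.cast_ne_zero.mpr Fintype.card_ne_zero
  have hclass : ∀ x : G, R.character x = classCharacter R (ConjClasses.mk x) := fun _ => rfl
  simp only [fusionCoeff_dualRep_eq, dualRep_character]
  rw [← Finset.mul_sum, eq_inv_mul_iff_mul_eq₀ hcard, ← sum_conjClasses_mul_card_centralizer,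
    Finset.sum_comm, ← Equiv.sum_comp (Equiv.inv G)]
  refine Finset.sum_congr rfl fun g _ => ?_
  rw [← Finset.sum_mul, ← sum_irrepClass_character_mul_character_inv, mul_comm]
  simp only [Equiv.inv_apply, inv_inv, hclass]
  congr 1
  exact Finset.sum_congr rfl fun S _ => mul_comm _ _

theorem mainTheorem5 {G : Type u} [Group G] [Fintype G] [Fintype (ConjClasses G)]
    (R : FDRep ℂ G) [Simple R] :
    (∃ n : ℕ, ∑ C : ConjClasses G, classCharacter R C = (n : ℂ) ∧
      n = ∑ S : IrrepClass G, fusionCoeff S.rep (dualRep S.rep) R ∧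
      (0 < n ↔ ∃ S : FDRep ℂ G, Simple S ∧ ∃ f : R ⟶ S ⊗ dualRep S, f ≠ 0)) ∧
    (∀ S : IrrepClass G, (fusionCoeff S.rep (dualRep S.rep) R : ℂ) =
      (1 / (Fintype.card G : ℂ)) * ∑ g : G, S.rep.character g *
        (dualRep S.rep).character g * (starRingEnd ℂ) (R.character g)) := by
  refine ⟨⟨_, ?_, rfl, ?_⟩, fun S => ?_⟩
  · rw [sum_classCharacter_eq_sum_fusionCoeff, Nat.cast_sum]
  · rw [Finset.sum_pos_iff]
    constructor
    · rintro ⟨S, _, hS⟩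
      exact ⟨S.rep, inferInstance, (fusionCoeff_pos_iff _ _ _).mp hS⟩
    · rintro ⟨S, _, hS⟩
      obtain ⟨T, ⟨i⟩⟩ := IrrepClass.exists_iso S
      exact ⟨T, Finset.mem_univ _, by
        rw [fusionCoeff_dualRep_congr i]
        exact (fusionCoeff_pos_iff _ _ _).mpr hS⟩
  · rw [fusionCoeff_dualRep_eq, one_div]
    congr 1
    refine Finset.sum_congr rfl fun g _ => ?_
    congr 1
    exact Representation.character_inv_eq_conj R.ρ g
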